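/- A \emph{problem} is a partial multi-valued function $f:\subseteq\mathbb{N}^{\mathbb{N}}\rightrightarrows\mathbb{N}^{\mathbb{N}}$ on Baire space, i.e. an assignment of a set $f(p)\subseteq\mathbb{N}^{\mathbb{N}}$ to every $p\in\mathbb{N}^{\mathbb{N}}$, with domain $\operatorname{dom}(f)=\{p : f(p)\neq\emptyset\}$. For problems $f,g$ write $f\le_{\mathrm{W}} g$ ($f$ is Weihrauch reducible to $g$) if there are computable partial functionals $\Phi:\subseteq\mathbb{N}^{\mathbb{N}}\to\mathbb{N}^{\mathbb{N}}$ and $\Psi:\subseteq\mathbb{N}^{\mathbb{N}}\times\mathbb{N}^{\mathbb{N}}\to\mathbb{N}^{\mathbb{N}}$ such that for all $p\in\operatorname{dom}(f)$ we have $\Phi(p)\in\operatorname{dom}(g)$ and $\Psi(p,q)\in f(p)$ for all $q\in g(\Phi(p))$. Write $f<_{\mathrm{W}} g$ if $f\le_{\mathrm{W}} g$ and $g\not\le_{\mathrm{W}} f$. The Weihrauch degrees are the equivalence classes of problems under mutual Weihrauch reducibility, partially ordered by $\le_{\mathrm{W}}$. A problem $f$ is a \emph{minimal cover} of a problem $h$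 if, in the partial order of the Weihrauch degrees, the degree of $h$ is strictly below the degree of $f$ and no degree lies strictly between them. Let $\operatorname{id}$ be the identity function on $\mathbb{N}^{\mathbb{N}}$. Let $g$ be a problem. The following are equivalent: \begin{enumerate} \item $\operatorname{id}\not\le_{\mathrm{W}} g$ (that is, $g$ is non-pointed); \item there are problems $f,h$ such that $g\le_{\mathrm{W}} h<_{\mathrm{W}} f$ and $f$ is a minimal cover of $h$. \end{enumerate} -/

import Mathlib

namespace Weihrauch

/-- Baire space. -/
abbrev Baire : Type := ℕ → ℕ

/-- The word `p 0, …, p (n - 1)`. -/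
def initSeg (p : Baire) (n : ℕ) : List ℕ := (List.range n).map p

/-- The words `w 0, w 1, …` are initial segments of `q`, of unbounded length. -/
def ConvergesTo (w : ℕ → List ℕ) (q : Baire) : Prop :=
  (∀ n, w n = initSeg q (w n).length) ∧ ∀ m, ∃ n, m ≤ (w n).length

/-- Computable partial functionals on Baire space: `Φ` is the functional induced by a computable
word function `φ`, monotone for the prefix order, where `φ σ` is the part of the output that a
machine has written after `σ.length` steps, in which it has read at most the part `σ` of its input.
The domain of `Φ` consists of exactly those inputs on which the output is infinite. -/
def ComputableFunctional (Φ : Baire →. Baire) : Prop :=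
  ∃ φ : List ℕ → List ℕ, Computable φ ∧
    (∀ σ σ', σ <+: σ' → φ σ <+: φ σ') ∧
    ∀ p q, q ∈ Φ p ↔ ConvergesTo (fun n => φ (initSeg p n)) q

/-- The same for partial functionals with two inputs. -/
def ComputableFunctional₂ (Ψ : Baire × Baire →. Baire) : Prop :=
  ∃ ψ : List ℕ → List ℕ → List ℕ, Computable₂ ψ ∧
    (∀ σ σ' τ τ', σ <+: σ' → τ <+: τ' → ψ σ τ <+: ψ σ' τ') ∧
    ∀ p q r, r ∈ Ψ (p, q) ↔ ConvergesTo (fun n => ψ (initSeg p n) (initSeg q n)) r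

/-- A partial multi-valued function on Baire space; `sol p` is the set of its values at `p`. -/
structure Problem : Type where
  sol : Baire → Set Baire

namespace Problem

/-- The domain: the points at which there is a value. -/
def dom (f : Problem) : Set Baire := {p | (f.sol p).Nonempty}

/-- The identity function on Baire space. -/
def identity : Problem := ⟨fun p => {p}⟩

end Problem

/-- Weihrauch reducibility of `f` to `g`. -/
def Reducible (f g : Problem) : Prop :=
  ∃ (Φ : Baire →. Baire) (Ψ : Baire × Baire →. Baire),
    ComputableFunctional Φ ∧ ComputableFunctional₂ Ψ ∧
    ∀ p ∈ f.dom, ∃ r ∈ Φ p, r ∈ g.dom ∧ ∀ q ∈ g.sol r, ∃ s ∈ Ψ (p, q), s ∈ f.sol p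

/-! Weihrauch reducibility is a preorder. -/

theorem length_initSeg (p : Baire) (n : ℕ) : (initSeg p n).length = n := by
  simp [initSeg]

theorem initSeg_prefix (p : Baire) {m n : ℕ} (h : m ≤ n) : initSeg p m <+: initSeg p n := by
  obtain ⟨k, rfl⟩ := Nat.exists_eq_add_of_le h
  simp [initSeg, List.range_add]

theorem eq_initSeg_of_prefix {p : Baire} {σ : List ℕ} {n : ℕ} (h : σ <+: initSeg p n) :
    σ = initSeg p σ.length := by
  have hl : σ.length ≤ n := by simpa [length_initSeg] using h.length_le
  exact (List.prefix_of_prefix_length_le h (initSeg_prefix p hl)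
    (by simp [length_initSeg])).eq_of_length (by simp [length_initSeg])

theorem ConvergesTo.unique {w : ℕ → List ℕ} {q r : Baire} (hq : ConvergesTo w q)
    (hr : ConvergesTo w r) : q = r := by
  funext i
  obtain ⟨n, hn⟩ := hq.2 (i + 1)
  have h : initSeg q (w n).length = initSeg r (w n).length := (hq.1 n).symm.trans (hr.1 n)
  have h' := congrArg (fun l : List ℕ => l[i]?) h
  simpa [initSeg, List.getElem?_range (show i < (w n).length by omega)] using h'

theorem convergesTo_initSeg (p : Baire) : ConvergesTo (initSeg p) p :=
  ⟨fun n => by rw [length_initSeg], fun m => ⟨m, by rw [length_initSeg]⟩⟩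

/-- The limit of a sequence of words. -/
noncomputable def limit (w : ℕ → List ℕ) : Part Baire :=
  ⟨∃ q, ConvergesTo w q, fun h => h.choose⟩

theorem mem_limit {w : ℕ → List ℕ} {q : Baire} : q ∈ limit w ↔ ConvergesTo w q := by
  constructor
  · rintro ⟨h, rfl⟩
    exact h.choose_spec
  · intro h
    exact ⟨⟨q, h⟩, (Exists.choose_spec (⟨q, h⟩ : ∃ q, ConvergesTo w q)).unique h⟩

/-- Monotone word functions may be applied to any words that converge to the inputs. -/
theorem ConvergesTo.map₂ {ψ : List ℕ → List ℕ → List ℕ}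
    (hψ : ∀ σ σ' τ τ', σ <+: σ' → τ <+: τ' → ψ σ τ <+: ψ σ' τ')
    {v w : ℕ → List ℕ} {p q r : Baire} (hv : ConvergesTo v p) (hw : ConvergesTo w q)
    (hvm : ∀ m n, m ≤ n → v m <+: v n) (hwm : ∀ m n, m ≤ n → w m <+: w n)
    (h : ConvergesTo (fun n => ψ (initSeg p n) (initSeg q n)) r) :
    ConvergesTo (fun n => ψ (v n) (w n)) r := by
  constructor
  · intro n
    have h1 : ψ (v n) (w n) <+: ψ (initSeg p (max (v n).length (w n).length))
        (initSeg q (max (v n).length (w n).length)) := by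
      apply hψ
      · conv_lhs => rw [hv.1 n]
        exact initSeg_prefix p (le_max_left _ _)
      · conv_lhs => rw [hw.1 n]
        exact initSeg_prefix q (le_max_right _ _)
    have h2 := h.1 (max (v n).length (w n).length)
    dsimp only at h2
    rw [h2] at h1
    exact eq_initSeg_of_prefix h1
  · intro m
    obtain ⟨k, hk⟩ := h.2 m
    obtain ⟨a, ha⟩ := hv.2 k
    obtain ⟨b, hb⟩ := hw.2 k
    refine ⟨max a b, hk.trans (List.IsPrefix.length_le (hψ _ _ _ _ ?_ ?_))⟩
    · refine List.IsPrefix.trans ?_ (hvm a _ (le_max_left _ _))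
      rw [hv.1 a]
      exact initSeg_prefix p ha
    · refine List.IsPrefix.trans ?_ (hwm b _ (le_max_right _ _))
      rw [hw.1 b]
      exact initSeg_prefix q hb

theorem Reducible.refl (f : Problem) : Reducible f f := by
  refine ⟨fun p => limit (initSeg p), fun x => limit (initSeg x.2),
    ⟨fun σ => σ, Computable.id, fun _ _ h => h, fun _ _ => mem_limit⟩,
    ⟨fun _ τ => τ, Computable.snd, fun _ _ _ _ _ h => h, fun _ _ _ => mem_limit⟩, ?_⟩
  intro p hp
  exact ⟨p, mem_limit.2 (convergesTo_initSeg p), hp,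
    fun q hq => ⟨q, mem_limit.2 (convergesTo_initSeg q), hq⟩⟩

theorem Reducible.trans {f g h : Problem} (hfg : Reducible f g) (hgh : Reducible g h) :
    Reducible f h := by
  obtain ⟨Φ₁, Ψ₁, ⟨φ₁, cφ₁, mφ₁, eφ₁⟩, ⟨ψ₁, cψ₁, mψ₁, eψ₁⟩, H₁⟩ := hfg
  obtain ⟨Φ₂, Ψ₂, ⟨φ₂, cφ₂, mφ₂, eφ₂⟩, ⟨ψ₂, cψ₂, mψ₂, eψ₂⟩, H₂⟩ := hgh
  have mono : ∀ (p : Baire) (m n : ℕ), m ≤ n → initSeg p m <+: initSeg p n :=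
    fun p _ _ => initSeg_prefix p
  refine ⟨fun p => limit fun n => φ₂ (φ₁ (initSeg p n)),
    fun x => limit fun n => ψ₁ (initSeg x.1 n) (ψ₂ (φ₁ (initSeg x.1 n)) (initSeg x.2 n)),
    ⟨fun σ => φ₂ (φ₁ σ), cφ₂.comp cφ₁, fun _ _ h => mφ₂ _ _ (mφ₁ _ _ h), fun _ _ => mem_limit⟩,
    ⟨fun σ τ => ψ₁ σ (ψ₂ (φ₁ σ) τ),
      cψ₁.comp Computable.fst (cψ₂.comp (cφ₁.comp Computable.fst) Computable.snd),
      fun _ _ _ _ h h' => mψ₁ _ _ _ _ h (mψ₂ _ _ _ _ (mφ₁ _ _ h) h'), fun _ _ _ => mem_limit⟩,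
    ?_⟩
  intro p hp
  obtain ⟨r, hr, hrg, H₁'⟩ := H₁ p hp
  obtain ⟨t, ht, hth, H₂'⟩ := H₂ r hrg
  have hr' := (eφ₁ p r).1 hr
  have hrm : ∀ m n, m ≤ n → φ₁ (initSeg p m) <+: φ₁ (initSeg p n) :=
    fun m n hmn => mφ₁ _ _ (mono p m n hmn)
  refine ⟨t, mem_limit.2 ?_, hth, fun q hq => ?_⟩
  · exact ConvergesTo.map₂ (ψ := fun σ _ => φ₂ σ) (fun _ _ _ _ h _ => mφ₂ _ _ h)
      hr' hr' hrm hrm ((eφ₂ r t).1 ht)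
  · obtain ⟨s, hs, hsg⟩ := H₂' q hq
    obtain ⟨u, hu, huf⟩ := H₁' s hsg
    refine ⟨u, mem_limit.2 ?_, huf⟩
    have hs' := ConvergesTo.map₂ mψ₂ hr' (convergesTo_initSeg q) hrm (mono q)
      ((eψ₂ r q s).1 hs)
    exact ConvergesTo.map₂ mψ₁ (convergesTo_initSeg p) hs' (mono p)
      (fun m n hmn => mψ₂ _ _ _ _ (hrm m n hmn) (mono q m n hmn)) ((eψ₁ p s u).1 hu)

/-- `f ≤ g` is Weihrauch reducibility, and `f < g` is strict Weihrauch reducibility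
(`f ≤ g` and not `g ≤ f`). -/
instance : Preorder Problem where
  le := Reducible
  le_refl := Reducible.refl
  le_trans _ _ _ := Reducible.trans

/-- The partial order of the Weihrauch degrees. -/
abbrev Degree : Type := Antisymmetrization Problem (· ≤ ·)

/-- The Weihrauch degree of a problem. -/
def degree (f : Problem) : Degree := toAntisymmetrization (· ≤ ·) f

/-- In a partial order, `a` is a minimal cover of `b`: `b < a`, with nothing strictly between. -/
def IsMinimalCover {α : Type*} [PartialOrder α] (a b : α) : Prop := b ⋖ a

end Weihrauch

namespace Weihrauch

/-! ### Words and their limits -/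

/-! A problem lies above `id` exactly when it has a computable instance (`identity_le_iff`). If `g`
has none, let `f` be the coproduct of `g` and `id`, and `h` the coproduct of `g` and the identity on
noncomputable points. All instances of `h` are noncomputable, so `h < f`. A problem `k` between them
that has a computable instance bounds both `g` and `id`, hence `f`. If it has none, then `k ≤ h`: a
call to `id` made for an instance `p` can be replaced by a call at the noncomputable point `p`
(`le_join_noncomputableIdentity`).

Conversely, the strict order is dense above `id`. Let `h < f`, let `r` be a computable instance of
`h`, and let `R` be its solution set. `intermediate` adds to `h`, for each `n`, the task of solving
`f` or naming `c n + 1` together with a point of `R`. If `c` is computable, the second option costs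
one call to `h`; if `c` is unknown, the number cannot be guessed. By Baire category, some `c`
defeats all countably many candidate reductions of `intermediate` to `h` and of `f` to
`intermediate` (`dense_not_solves_intermediate_left`, `dense_not_solves_intermediate_right`). -/

/-- The sequence without its first entry. -/
def Baire.tail (p : Baire) : Baire := fun i => p (i + 1)

/-- The sequence with a first entry prepended. -/
def Baire.cons (a : ℕ) (p : Baire) : Baire := fun i => Nat.casesOn i a p

theorem initSeg_cons (a : ℕ) (p : Baire) (n : ℕ) :
    initSeg (Baire.cons a p) (n + 1) = a :: initSeg p n := by
  simp [initSeg, List.range_succ_eq_map, Baire.cons, Function.comp_def]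

theorem initSeg_succ (p : Baire) (n : ℕ) :
    initSeg p (n + 1) = p 0 :: initSeg p.tail n := by
  simp [initSeg, List.range_succ_eq_map, Baire.tail, Function.comp_def]

/-- A sequence of words that increases in the prefix order. -/
def MonoSeq (w : ℕ → List ℕ) : Prop := ∀ m n, m ≤ n → w m <+: w n

/-- A word function that is monotone in the prefix order. -/
def MonoWord (φ : List ℕ → List ℕ) : Prop := ∀ σ σ', σ <+: σ' → φ σ <+: φ σ'

/-- A binary word function that is monotone in the prefix order. -/
def MonoWord₂ (ψ : List ℕ → List ℕ → List ℕ) : Prop :=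
  ∀ σ σ' τ τ', σ <+: σ' → τ <+: τ' → ψ σ τ <+: ψ σ' τ'

theorem monoSeq_initSeg (p : Baire) : MonoSeq (initSeg p) := fun _ _ => initSeg_prefix p

theorem MonoWord.monoSeq {φ : List ℕ → List ℕ} (hφ : MonoWord φ) {w : ℕ → List ℕ}
    (hw : MonoSeq w) : MonoSeq fun n => φ (w n) :=
  fun m n h => hφ _ _ (hw m n h)

theorem MonoWord₂.monoSeq {ψ : List ℕ → List ℕ → List ℕ} (hψ : MonoWord₂ ψ)
    {v w : ℕ → List ℕ} (hv : MonoSeq v) (hw : MonoSeq w) : MonoSeq fun n => ψ (v n) (w n) :=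
  fun m n h => hψ _ _ _ _ (hv m n h) (hw m n h)

theorem prefix_tail {σ τ : List ℕ} (h : σ <+: τ) : σ.tail <+: τ.tail := by
  obtain ⟨ρ, rfl⟩ := h
  cases σ <;> simp

theorem MonoSeq.tail {w : ℕ → List ℕ} (hw : MonoSeq w) : MonoSeq fun n => (w n).tail :=
  fun m n h => prefix_tail (hw m n h)

theorem MonoSeq.cons {w : ℕ → List ℕ} (hw : MonoSeq w) (a : ℕ) : MonoSeq fun n => a :: w n :=
  fun m n h => List.cons_prefix_cons.2 ⟨rfl, hw m n h⟩

theorem ConvergesTo.cons {w : ℕ → List ℕ} {p : Baire} (h : ConvergesTo w p) (a : ℕ) :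
    ConvergesTo (fun n => a :: w n) (Baire.cons a p) := by
  refine ⟨fun n => ?_, fun m => ?_⟩
  · rw [List.length_cons, initSeg_cons, ← h.1 n]
  · obtain ⟨n, hn⟩ := h.2 m
    exact ⟨n, by simp; omega⟩

theorem ConvergesTo.tail {w : ℕ → List ℕ} {p : Baire} (h : ConvergesTo w p) :
    ConvergesTo (fun n => (w n).tail) p.tail := by
  refine ⟨fun n => ?_, fun m => ?_⟩
  · have h1 := h.1 n
    dsimp only
    cases hw : w n with
    | nil => simp [initSeg]
    | cons a t =>
      rw [hw, List.length_cons, initSeg_succ] at h1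
      simpa using (List.cons.inj h1).2
  · obtain ⟨n, hn⟩ := h.2 (m + 1)
    exact ⟨n, by simp; omega⟩

theorem ConvergesTo.map {φ : List ℕ → List ℕ} (hφ : MonoWord φ) {w : ℕ → List ℕ} {p q : Baire}
    (hw : ConvergesTo w p) (hwm : MonoSeq w) (h : ConvergesTo (fun n => φ (initSeg p n)) q) :
    ConvergesTo (fun n => φ (w n)) q :=
  ConvergesTo.map₂ (ψ := fun σ _ => φ σ) (fun _ _ _ _ h _ => hφ _ _ h) hw hw hwm hwm h

/-- The word `F a`, where `a` is the first letter of `w`, once there is one. -/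
def caseHead (w : List ℕ) (F : ℕ → List ℕ) : List ℕ :=
  Option.casesOn w.head? [] F

theorem caseHead_prefix {w w' : List ℕ} {F F' : ℕ → List ℕ} (hw : w <+: w')
    (hF : ∀ a, F a <+: F' a) : caseHead w F <+: caseHead w' F' := by
  obtain ⟨t, rfl⟩ := hw
  cases w with
  | nil => exact List.nil_prefix
  | cons a w => exact hF a

theorem computable_caseHead {α : Type*} [Primcodable α] {w : α → List ℕ} {F : α → ℕ → List ℕ}
    (hw : Computable w) (hF : Computable₂ F) : Computable fun x => caseHead (w x) (F x) :=
  Computable.option_casesOn (Primrec.list_head?.to_comp.comp hw) (Computable.const []) hF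

theorem ConvergesTo.caseHead {w : ℕ → List ℕ} {F : ℕ → ℕ → List ℕ} {p q : Baire}
    (hw : ConvergesTo w p) (hwm : MonoSeq w) (hF : ConvergesTo (fun n => F n (p 0)) q)
    (hFm : MonoSeq fun n => F n (p 0)) :
    ConvergesTo (fun n => caseHead (w n) (F n)) q := by
  have key : ∀ n, w n ≠ [] → Weihrauch.caseHead (w n) (F n) = F n (p 0) := by
    intro n hn
    have h1 := hw.1 n
    cases hwn : w n with
    | nil => exact absurd hwn hn
    | cons a t =>
      rw [hwn, List.length_cons, initSeg_succ] at h1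
      rw [← (List.cons.inj h1).1]
      rfl
  refine ⟨fun n => ?_, fun m => ?_⟩
  · by_cases hn : w n = []
    · simp [hn, Weihrauch.caseHead, initSeg]
    · dsimp only
      rw [key n hn]
      exact hF.1 n
  · obtain ⟨a, ha⟩ := hw.2 1
    obtain ⟨b, hb⟩ := hF.2 m
    refine ⟨max a b, ?_⟩
    have h1 := (hwm a _ (le_max_left a b)).length_le
    have h2 := (hFm b _ (le_max_right a b)).length_le
    dsimp only at h2 hb ⊢
    rw [key]
    · omega
    · intro h0
      rw [h0, List.length_nil] at h1
      omega

/-! ### Reductions given by word functions -/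

/-- The word functions `φ` and `ψ` translate instances of `f` to instances of `g`, and solutions
back. -/
def Solves (φ : List ℕ → List ℕ) (ψ : List ℕ → List ℕ → List ℕ) (f g : Problem) : Prop :=
  ∀ p ∈ f.dom, ∃ r, ConvergesTo (fun n => φ (initSeg p n)) r ∧ r ∈ g.dom ∧
    ∀ q ∈ g.sol r, ∃ s, ConvergesTo (fun n => ψ (initSeg p n) (initSeg q n)) s ∧ s ∈ f.sol p

theorem le_iff_exists_solves {f g : Problem} :
    f ≤ g ↔ ∃ φ ψ, Computable φ ∧ Computable₂ ψ ∧ MonoWord φ ∧ MonoWord₂ ψ ∧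
      Solves φ ψ f g := by
  constructor
  · rintro ⟨Φ, Ψ, ⟨φ, cφ, mφ, eφ⟩, ⟨ψ, cψ, mψ, eψ⟩, H⟩
    refine ⟨φ, ψ, cφ, cψ, mφ, mψ, fun p hp => ?_⟩
    obtain ⟨r, hr, hrg, H'⟩ := H p hp
    refine ⟨r, (eφ p r).1 hr, hrg, fun q hq => ?_⟩
    obtain ⟨s, hs, hsf⟩ := H' q hq
    exact ⟨s, (eψ p q s).1 hs, hsf⟩
  · rintro ⟨φ, ψ, cφ, cψ, mφ, mψ, H⟩
    refine ⟨fun p => limit fun n => φ (initSeg p n),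
      fun x => limit fun n => ψ (initSeg x.1 n) (initSeg x.2 n),
      ⟨φ, cφ, mφ, fun _ _ => mem_limit⟩, ⟨ψ, cψ, mψ, fun _ _ _ => mem_limit⟩, fun p hp => ?_⟩
    obtain ⟨r, hr, hrg, H'⟩ := H p hp
    refine ⟨r, mem_limit.2 hr, hrg, fun q hq => ?_⟩
    obtain ⟨s, hs, hsf⟩ := H' q hq
    exact ⟨s, mem_limit.2 hs, hsf⟩

/-- The problems `F 0, F 1, …` are reducible to `c`, uniformly. -/
def UniformlyReducible (F : ℕ → Problem) (c : Problem) : Prop :=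
  ∃ (φ : ℕ → List ℕ → List ℕ) (ψ : ℕ → List ℕ → List ℕ → List ℕ),
    Computable₂ φ ∧ Computable (fun x : ℕ × List ℕ × List ℕ => ψ x.1 x.2.1 x.2.2) ∧
    ∀ n, MonoWord (φ n) ∧ MonoWord₂ (ψ n) ∧ Solves (φ n) (ψ n) (F n) c

/-- The coproduct of countably many problems: an instance of `F n`, tagged with `n`. -/
def sigma (F : ℕ → Problem) : Problem := ⟨fun p => (F (p 0)).sol p.tail⟩

/-- The sequence of problems `a, F 0, F 1, …`. -/
def consFamily (a : Problem) (F : ℕ → Problem) : ℕ → Problem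
  | 0 => a
  | n + 1 => F n

/-- The coproduct of two problems. -/
def join (a b : Problem) : Problem := sigma (consFamily a fun _ => b)

theorem le_sigma (F : ℕ → Problem) (n : ℕ) : F n ≤ sigma F := by
  refine le_iff_exists_solves.2 ⟨fun σ => n :: σ, fun _ τ => τ,
    (Primrec.list_cons.comp (Primrec.const n) Primrec.id).to_comp, Computable.snd,
    fun _ _ h => List.cons_prefix_cons.2 ⟨rfl, h⟩, fun _ _ _ _ _ h => h, fun p hp => ?_⟩
  exact ⟨Baire.cons n p, (convergesTo_initSeg p).cons n, hp,
    fun q hq => ⟨q, convergesTo_initSeg q, hq⟩⟩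

theorem sigma_le {F : ℕ → Problem} {c : Problem} (h : UniformlyReducible F c) : sigma F ≤ c := by
  obtain ⟨φ, ψ, cφ, cψ, H⟩ := h
  refine le_iff_exists_solves.2 ⟨fun σ => caseHead σ fun n => φ n σ.tail,
    fun σ τ => caseHead σ fun n => ψ n σ.tail τ, ?_, ?_, ?_, ?_, fun p hp => ?_⟩
  · exact computable_caseHead Computable.id
      (cφ.comp Computable.snd (Primrec.list_tail.to_comp.comp Computable.fst))
  · refine computable_caseHead (α := List ℕ × List ℕ) Computable.fst ?_
    exact cψ.comp (Computable.snd.pair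
      ((Primrec.list_tail.to_comp.comp (Computable.fst.comp Computable.fst)).pair
        (Computable.snd.comp Computable.fst)))
  · exact fun σ σ' h => caseHead_prefix h fun n => (H n).1 _ _ (prefix_tail h)
  · exact fun σ σ' τ τ' h h' => caseHead_prefix h fun n => (H n).2.1 _ _ _ _ (prefix_tail h) h'
  · obtain ⟨m₁, m₂, H'⟩ := H (p 0)
    obtain ⟨r, hr, hrc, H''⟩ := H' p.tail hp
    have ht := (convergesTo_initSeg p).tail
    have htm := (monoSeq_initSeg p).tail
    refine ⟨r, (convergesTo_initSeg p).caseHead (monoSeq_initSeg p)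
      (ConvergesTo.map m₁ ht htm hr) (m₁.monoSeq htm), hrc, fun q hq => ?_⟩
    obtain ⟨s, hs, hsf⟩ := H'' q hq
    exact ⟨s, (convergesTo_initSeg p).caseHead (monoSeq_initSeg p)
      (ConvergesTo.map₂ m₂ ht (convergesTo_initSeg q) htm (monoSeq_initSeg q) hs)
      (m₂.monoSeq htm (monoSeq_initSeg q)), hsf⟩

theorem uniformlyReducible_const {b c : Problem} (h : b ≤ c) :
    UniformlyReducible (fun _ => b) c := by
  obtain ⟨φ, ψ, cφ, cψ, mφ, mψ, H⟩ := le_iff_exists_solves.1 h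
  exact ⟨fun _ => φ, fun _ => ψ, cφ.comp Computable.snd,
    Computable₂.comp cψ (Computable.fst.comp Computable.snd) (Computable.snd.comp Computable.snd),
    fun _ => ⟨mφ, mψ, H⟩⟩

theorem UniformlyReducible.consFamily {a c : Problem} {F : ℕ → Problem} (ha : a ≤ c)
    (hF : UniformlyReducible F c) : UniformlyReducible (consFamily a F) c := by
  obtain ⟨φ₀, ψ₀, cφ₀, cψ₀, mφ₀, mψ₀, H₀⟩ := le_iff_exists_solves.1 ha
  obtain ⟨φ, ψ, cφ, cψ, H⟩ := hF
  refine ⟨fun n σ => Nat.casesOn n (φ₀ σ) fun k => φ k σ,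
    fun n σ τ => Nat.casesOn n (ψ₀ σ τ) fun k => ψ k σ τ, ?_, ?_, fun n => ?_⟩
  · exact Computable.nat_casesOn (α := ℕ × List ℕ) Computable.fst (cφ₀.comp Computable.snd)
      (cφ.comp Computable.snd (Computable.snd.comp Computable.fst))
  · have cψ' : Computable fun x : (ℕ × List ℕ × List ℕ) × ℕ => ψ x.2 x.1.2.1 x.1.2.2 :=
      Computable.comp (f := fun x : ℕ × List ℕ × List ℕ => ψ x.1 x.2.1 x.2.2)
        (g := fun x : (ℕ × List ℕ × List ℕ) × ℕ => (x.2, x.1.2)) cψ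
        (Computable.snd.pair (Computable.snd.comp Computable.fst))
    exact Computable.nat_casesOn (α := ℕ × List ℕ × List ℕ) Computable.fst
      (cψ₀.comp (Computable.fst.comp Computable.snd) (Computable.snd.comp Computable.snd))
      cψ'
  · cases n with
    | zero => exact ⟨mφ₀, mψ₀, H₀⟩
    | succ k => exact H k

theorem join_le {a b c : Problem} (ha : a ≤ c) (hb : b ≤ c) : join a b ≤ c :=
  sigma_le (.consFamily ha (uniformlyReducible_const hb))

theorem left_le_join (a b : Problem) : a ≤ join a b := le_sigma (consFamily a fun _ => b) 0

theorem right_le_join (a b : Problem) : b ≤ join a b := le_sigma (consFamily a fun _ => b) 1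

/-! ### Computable instances -/

/-- A computable point: the constant function with that value is a computable functional. -/
def IsComputablePoint (p : Baire) : Prop :=
  ∃ φ : List ℕ → List ℕ, Computable φ ∧ MonoWord φ ∧
    ∀ q, ConvergesTo (fun n => φ (initSeg q n)) p

theorem IsComputablePoint.tail {p : Baire} (h : IsComputablePoint p) :
    IsComputablePoint p.tail := by
  obtain ⟨φ, cφ, mφ, H⟩ := h
  exact ⟨fun σ => (φ σ).tail, Primrec.list_tail.to_comp.comp cφ,
    fun _ _ h => prefix_tail (mφ _ _ h), fun q => (H q).tail⟩

theorem identity_le_iff {g : Problem} :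
    Problem.identity ≤ g ↔ ∃ r ∈ g.dom, IsComputablePoint r := by
  constructor
  · intro h
    obtain ⟨φ, ψ, cφ, cψ, mφ, mψ, H⟩ := le_iff_exists_solves.1 h
    obtain ⟨r, hr, hrg, -⟩ := H (fun _ => 0) (Set.singleton_nonempty _)
    -- Only the length of the input is used, as a clock; the letters read are those of the zero
    -- sequence.
    refine ⟨r, hrg, fun σ => φ (σ.map fun _ => 0), ?_, fun σ σ' h => mφ _ _ (h.map _), fun q => ?_⟩
    · exact cφ.comp (Primrec.list_map Primrec.id (Primrec.const 0).to₂).to_comp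
    · simpa [initSeg, Function.comp_def] using hr
  · rintro ⟨r, hr, φ, cφ, mφ, H⟩
    exact le_iff_exists_solves.2 ⟨φ, fun σ _ => σ, cφ, Computable.fst, mφ,
      fun _ _ _ _ h _ => h, fun p _ => ⟨r, H p, hr, fun q _ => ⟨p, convergesTo_initSeg p, rfl⟩⟩⟩

/-- The identity on the noncomputable points. -/
def noncomputableIdentity : Problem := ⟨fun p => {s | s = p ∧ ¬ IsComputablePoint p}⟩

theorem noncomputableIdentity_le_identity : noncomputableIdentity ≤ Problem.identity := by
  refine le_iff_exists_solves.2 ⟨fun σ => σ, fun _ τ => τ, Computable.id, Computable.snd,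
    fun _ _ h => h, fun _ _ _ _ _ h => h, fun p ⟨_, hs⟩ => ?_⟩
  refine ⟨p, convergesTo_initSeg p, Set.singleton_nonempty p, fun q hq => ?_⟩
  exact ⟨q, convergesTo_initSeg q, hq, hs.2⟩

theorem le_join_noncomputableIdentity {g k : Problem} (hk : ∀ p ∈ k.dom, ¬ IsComputablePoint p)
    (h : k ≤ join g Problem.identity) : k ≤ join g noncomputableIdentity := by
  obtain ⟨φ, ψ, cφ, cψ, mφ, mψ, H⟩ := le_iff_exists_solves.1 h
  refine le_iff_exists_solves.2
    -- Calls to `g` are kept. A call to `id` becomes a call at `p`, whose answer is ignored: the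
    -- answer of `id` is its own input, which is recomputed from `p` as the tail of `φ`.
    ⟨fun σ => caseHead (φ σ) fun n => Nat.casesOn n (φ σ) fun _ => 1 :: σ,
    fun σ τ => caseHead (φ σ) fun n => Nat.casesOn n (ψ σ τ) fun _ => ψ σ (φ σ).tail,
    ?_, ?_, ?_, ?_, fun p hp => ?_⟩
  · refine computable_caseHead cφ ?_
    exact Computable.nat_casesOn (α := List ℕ × ℕ) Computable.snd (cφ.comp Computable.fst)
      (Computable.list_cons.comp (Computable.const 1) (Computable.fst.comp Computable.fst))
  · refine computable_caseHead (α := List ℕ × List ℕ) (cφ.comp Computable.fst) ?_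
    exact Computable.nat_casesOn (α := (List ℕ × List ℕ) × ℕ) Computable.snd
      (cψ.comp (Computable.fst.comp Computable.fst) (Computable.snd.comp Computable.fst))
      (cψ.comp (Computable.fst.comp (Computable.fst.comp Computable.fst))
        (Primrec.list_tail.to_comp.comp
          (cφ.comp (Computable.fst.comp (Computable.fst.comp Computable.fst)))))
  · refine fun σ σ' h => caseHead_prefix (mφ _ _ h) fun n => ?_
    cases n with
    | zero => exact mφ _ _ h
    | succ n => exact List.cons_prefix_cons.2 ⟨rfl, h⟩
  · refine fun σ σ' τ τ' h h' => caseHead_prefix (mφ _ _ h) fun n => ?_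
    cases n with
    | zero => exact mψ _ _ _ _ h h'
    | succ n => exact mψ _ _ _ _ h (prefix_tail (mφ _ _ h))
  · obtain ⟨r, hr, hrd, H'⟩ := H p hp
    have hpm := monoSeq_initSeg p
    have hrm := mφ.monoSeq hpm
    cases h0 : r 0 with
    | zero =>
      have e : ∀ b, (join g b).sol r = g.sol r.tail := fun b => by
        simp only [join, sigma, h0, consFamily]
      have hrd' : (g.sol r.tail).Nonempty := e Problem.identity ▸ hrd
      rw [e] at H'
      refine ⟨r, hr.caseHead hrm (by rw [h0]; exact hr) (by rw [h0]; exact hrm), ?_, ?_⟩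
      · change ((join g _).sol r).Nonempty
        rw [e]
        exact hrd'
      · rw [e]
        intro q hq
        obtain ⟨s, hs, hsk⟩ := H' q hq
        exact ⟨s, hr.caseHead hrm (by rw [h0]; exact hs)
          (by rw [h0]; exact mψ.monoSeq hpm (monoSeq_initSeg q)), hsk⟩
    | succ n =>
      have e : (join g Problem.identity).sol r = {r.tail} := by
        simp only [join, sigma, h0, consFamily, Problem.identity]
      rw [e] at H'
      obtain ⟨s, hs, hsk⟩ := H' r.tail rfl
      refine ⟨Baire.cons 1 p, hr.caseHead hrm (by rw [h0]; exact (convergesTo_initSeg p).cons 1)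
        (by rw [h0]; exact hpm.cons 1), ⟨p, rfl, hk p hp⟩, fun q _ => ⟨s, ?_, hsk⟩⟩
      refine hr.caseHead hrm ?_ ?_ <;> rw [h0]
      · exact ConvergesTo.map₂ mψ (convergesTo_initSeg p) hr.tail hpm hrm.tail hs
      · exact mψ.monoSeq hpm hrm.tail

/-- A computable instance of the right-hand side would have a computable tail, which is an instance
of `g` or a noncomputable point. -/
theorem not_join_identity_le {g : Problem} (hg : ¬ Problem.identity ≤ g) :
    ¬ join g Problem.identity ≤ join g noncomputableIdentity := by
  intro h
  obtain ⟨r, ⟨s, hs⟩, hr⟩ := identity_le_iff.1 ((right_le_join g _).trans h)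
  cases h0 : r 0 with
  | zero =>
    simp only [join, sigma, h0, consFamily] at hs
    exact hg (identity_le_iff.2 ⟨r.tail, ⟨s, hs⟩, hr.tail⟩)
  | succ n =>
    simp only [join, sigma, h0, consFamily] at hs
    exact hs.2 hr.tail

/-! ### Minimal covers of degrees, in terms of problems -/

theorem degree_lt_degree {a b : Problem} : degree a < degree b ↔ a < b :=
  toAntisymmetrization_lt_toAntisymmetrization_iff

theorem isMinimalCover_iff {f h : Problem} :
    IsMinimalCover (degree f) (degree h) ↔ h < f ∧ ∀ k, h < k → ¬ k < f := by
  constructor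
  · rintro ⟨h1, h2⟩
    exact ⟨degree_lt_degree.1 h1, fun k hk hk' =>
      h2 (degree_lt_degree.2 hk) (degree_lt_degree.2 hk')⟩
  · rintro ⟨h1, h2⟩
    refine ⟨degree_lt_degree.2 h1, fun c => ?_⟩
    induction c using Antisymmetrization.ind with
    | _ k => exact fun hk hk' => h2 k (degree_lt_degree.1 hk) (degree_lt_degree.1 hk')

theorem join_identity_isMinimalCover {g : Problem} (hg : ¬ Problem.identity ≤ g) :
    IsMinimalCover (degree (join g Problem.identity)) (degree (join g noncomputableIdentity)) := by
  refine isMinimalCover_iff.2 ⟨⟨join_le (left_le_join _ _)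
    (noncomputableIdentity_le_identity.trans (right_le_join _ _)), not_join_identity_le hg⟩,
    fun k hk hk' => ?_⟩
  by_cases hc : ∃ p ∈ k.dom, IsComputablePoint p
  · exact hk'.not_ge (join_le ((left_le_join _ _).trans hk.le) (identity_le_iff.2 hc))
  · push Not at hc
    exact hk.not_ge (le_join_noncomputableIdentity hc hk'.le)

/-! ### Density above the identity -/

/-- A computable function is determined by any code for it, and codes are countable. -/
theorem countable_computable {α β : Type*} [Primcodable α] [Primcodable β] :
    {f : α → β | Computable f}.Countable := by
  have key : ∀ f : {f : α → β | Computable f}, ∃ c : Nat.Partrec.Code, c.eval = fun n =>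
      Part.bind (Encodable.decode (α := α) n) fun a => Part.some (Encodable.encode (f.1 a)) := by
    intro f
    obtain ⟨c, hc⟩ := Nat.Partrec.Code.exists_code.1 f.2
    exact ⟨c, hc.trans (funext fun n => by congr 1)⟩
  choose code hcode using key
  refine Set.countable_coe_iff.1 (Function.Injective.countable (f := code) fun f g h => ?_)
  have h1 := (hcode f).symm.trans ((congrArg _ h).trans (hcode g))
  refine Subtype.ext (funext fun a => ?_)
  have h2 := congrFun h1 (Encodable.encode a)
  simpa using h2

/-- Countably many sets of sequences with dense interior have a common point. -/
theorem exists_forall_of_dense {ι : Type*} [Countable ι] (P : ι → Baire → Prop)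
    (h : ∀ i (c : Baire) N, ∃ c' : Baire, (∀ n < N, c' n = c n) ∧
      ∃ M, ∀ c'' : Baire, (∀ n < M, c'' n = c' n) → P i c'') : ∃ c, ∀ i, P i c := by
  have hd : Dense (⋂ i, interior {c | P i c}) := by
    refine dense_iInter_of_isOpen (fun _ => isOpen_interior) fun i => ?_
    refine (PiNat.isTopologicalBasis_cylinders (fun _ => ℕ)).dense_iff.2 ?_
    rintro _ ⟨c, N, rfl⟩ _
    obtain ⟨c', hc', M, hM⟩ := h i c N
    refine ⟨c', fun n hn => hc' n hn, mem_interior.2 ⟨PiNat.cylinder c' M, ?_,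
      PiNat.isOpen_cylinder _ _ _, PiNat.self_mem_cylinder _ _⟩⟩
    exact fun c'' hc'' => hM c'' fun n hn => hc'' n hn
  obtain ⟨c, hc⟩ := hd.nonempty
  exact ⟨c, fun i => interior_subset (Set.mem_iInter.1 hc i)⟩

/-- Given an instance of `f`, find the number `a` followed by a point of `R`. -/
def codedPoint (f : Problem) (R : Set Baire) (a : ℕ) : Problem :=
  ⟨fun p => {s | p ∈ f.dom ∧ s 0 = a ∧ s.tail ∈ R}⟩

/-- Solve `f`, or find the number `a + 1` followed by a point of `R`. -/
def solveOrCodedPoint (f : Problem) (R : Set Baire) (a : ℕ) : Problem :=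
  ⟨fun p => {s | (s 0 = 0 ∧ s.tail ∈ f.sol p) ∨ s ∈ (codedPoint f R (a + 1)).sol p}⟩

/-- An instance of `h`, or an instance of `solveOrCodedPoint f R (c n)`, for some `n`. -/
def intermediate (f h : Problem) (R : Set Baire) (c : Baire) : Problem :=
  sigma (consFamily h fun n => solveOrCodedPoint f R (c n))

/-- The tag `n + 1` consults only `c n`. This locality makes the failure of a reduction at one
instance persist for all nearby sequences. -/
theorem intermediate_sol_congr {f h : Problem} {R : Set Baire} {c c' p : Baire}
    (hc : ∀ n < p 0, c n = c' n) :
    (intermediate f h R c).sol p = (intermediate f h R c').sol p := by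
  cases h0 : p 0 with
  | zero => simp only [intermediate, sigma, h0, consFamily]
  | succ n => simp only [intermediate, sigma, h0, consFamily, hc n (by omega)]

theorem intermediate_le {f h : Problem} (hf : h ≤ f) (R : Set Baire) (c : Baire) :
    intermediate f h R c ≤ f := by
  refine sigma_le (.consFamily hf ⟨fun _ σ => σ, fun _ _ τ => 0 :: τ, Computable.snd,
    Computable.list_cons.comp (Computable.const 0) (Computable.snd.comp Computable.snd),
    fun n => ⟨fun _ _ h => h, fun _ _ _ _ _ h => List.cons_prefix_cons.2 ⟨rfl, h⟩,
      fun p hp => ?_⟩⟩)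
  have hp' : p ∈ f.dom := by
    obtain ⟨s, hs | hs⟩ := hp
    · exact ⟨_, hs.2⟩
    · exact hs.1
  exact ⟨p, convergesTo_initSeg p, hp', fun q hq =>
    ⟨Baire.cons 0 q, (convergesTo_initSeg q).cons 0, Or.inl ⟨rfl, hq⟩⟩⟩

/-- Every coded task is answered by one call to `h` at the computable `r`, with `c n + 1` prepended;
computability of `c` makes this uniform in `n`. -/
theorem sigma_codedPoint_le {f h : Problem} {r : Baire} (hr : r ∈ h.dom)
    (hrc : IsComputablePoint r) {c : Baire} (hc : Computable c) :
    sigma (consFamily h fun n => codedPoint f (h.sol r) (c n + 1)) ≤ h := by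
  obtain ⟨ρ, cρ, mρ, H⟩ := hrc
  refine sigma_le (.consFamily le_rfl ⟨fun _ => ρ, fun n _ τ => (c n + 1) :: τ,
    cρ.comp Computable.snd, Computable.list_cons.comp
      (Computable.succ.comp (hc.comp Computable.fst)) (Computable.snd.comp Computable.snd),
    fun n => ⟨mρ, fun _ _ _ _ _ h => List.cons_prefix_cons.2 ⟨rfl, h⟩, fun p ⟨_, hs⟩ => ?_⟩⟩)
  exact ⟨r, H p, hr, fun q hq =>
    ⟨Baire.cons (c n + 1) q, (convergesTo_initSeg q).cons _, hs.1, rfl, hq⟩⟩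

/-- Given an instance of `f` tagged with `n`, find a solution tagged with `0`. -/
def tagged (f : Problem) (n : ℕ) : Problem :=
  ⟨fun p => {s | p 0 = n ∧ s 0 = 0 ∧ s.tail ∈ f.sol p.tail}⟩

theorem le_tagged (f : Problem) (n : ℕ) : f ≤ tagged f n := by
  refine le_iff_exists_solves.2 ⟨fun σ => n :: σ, fun _ τ => τ.tail,
    (Primrec.list_cons.comp (Primrec.const n) Primrec.id).to_comp,
    Primrec.list_tail.to_comp.comp Computable.snd,
    fun _ _ h => List.cons_prefix_cons.2 ⟨rfl, h⟩, fun _ _ _ _ _ h => prefix_tail h,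
    fun p ⟨s, hs⟩ => ?_⟩
  exact ⟨Baire.cons n p, (convergesTo_initSeg p).cons n, ⟨Baire.cons 0 s, rfl, rfl, hs⟩,
    fun q hq => ⟨q.tail, (convergesTo_initSeg q).tail, hq.2.2⟩⟩

/-- The reduction does not see `c`. If it worked for two values of `c N`, its answer could not name
both numbers, so it would always solve `f`, giving `f ≤ h`. -/
theorem dense_not_solves_intermediate_left {f h : Problem} (hfh : ¬ f ≤ h) (R : Set Baire)
    {φ : List ℕ → List ℕ} {ψ : List ℕ → List ℕ → List ℕ} (cφ : Computable φ) (cψ : Computable₂ ψ)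
    (mφ : MonoWord φ) (mψ : MonoWord₂ ψ) (c : Baire) (N : ℕ) :
    ∃ c' : Baire, (∀ n < N, c' n = c n) ∧ ∃ M, ∀ c'' : Baire, (∀ n < M, c'' n = c' n) →
      ¬ Solves φ ψ (intermediate f h R c'') h := by
  -- The tag `N + 1` addresses `c N`, the first entry not yet fixed.
  have hT : ¬ Solves φ ψ (tagged f (N + 1)) h := fun H =>
    hfh ((le_tagged f (N + 1)).trans (le_iff_exists_solves.2 ⟨φ, ψ, cφ, cψ, mφ, mψ, H⟩))
  obtain ⟨p, ⟨t, hp0, ht⟩, hp⟩ : ∃ p ∈ (tagged f (N + 1)).dom, ¬ ∃ r, _ := by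
    simpa only [Solves, not_forall, exists_prop] using hT
  have hsol : ∀ c'' : Baire, (intermediate f h R c'').sol p =
      (solveOrCodedPoint f R (c'' N)).sol p.tail := fun c'' => by
    simp only [intermediate, sigma, hp0, consFamily]
  have hdom : ∀ c'', p ∈ (intermediate f h R c'').dom := fun c'' => by
    refine ⟨t, ?_⟩
    rw [hsol]
    exact Or.inl ht
  by_contra! hcon
  have hval : ∀ a, ∃ c'' : Baire, c'' N = a ∧ Solves φ ψ (intermediate f h R c'') h := by
    intro a
    obtain ⟨c'', h1, h2⟩ := hcon (Function.update c N a)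
      (fun n hn => Function.update_of_ne hn.ne _ _) (N + 1)
    exact ⟨c'', by rw [h1 N (Nat.lt_succ_self N), Function.update_self], h2⟩
  obtain ⟨c₀, h₀, H₀⟩ := hval 0
  obtain ⟨c₁, h₁, H₁⟩ := hval 1
  obtain ⟨r, hr, hrh, K₀⟩ := H₀ p (hdom c₀)
  obtain ⟨r', hr', -, K₁⟩ := H₁ p (hdom c₁)
  obtain rfl := hr.unique hr'
  refine hp ⟨r, hr, hrh, fun q hq => ?_⟩
  obtain ⟨s, hs, hs₀⟩ := K₀ q hq
  obtain ⟨s', hs', hs₁⟩ := K₁ q hq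
  obtain rfl := hs.unique hs'
  rw [hsol, h₀] at hs₀
  rw [hsol, h₁] at hs₁
  refine ⟨s, hs, hp0, ?_⟩
  rcases hs₀ with h | h
  · exact h
  · rcases hs₁ with h' | h'
    · exact h'
    · have e := h.2.1.symm.trans h'.2.1
      omega

/-- For a computable `c'`, restricting the answers to coded points gives a problem `G ≤ h`, so the
reduction fails from `f` to `G` at some `p`. As `G` has fewer solutions than `intermediate`, it also
fails there, and this depends on finitely many entries of `c'`. -/
theorem dense_not_solves_intermediate_right {f h : Problem} (hfh : ¬ f ≤ h) {r : Baire}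
    (hr : r ∈ h.dom) (hrc : IsComputablePoint r) {φ : List ℕ → List ℕ}
    {ψ : List ℕ → List ℕ → List ℕ} (cφ : Computable φ) (cψ : Computable₂ ψ)
    (mφ : MonoWord φ) (mψ : MonoWord₂ ψ) (c : Baire) (N : ℕ) :
    ∃ c' : Baire, (∀ n < N, c' n = c n) ∧ ∃ M, ∀ c'' : Baire, (∀ n < M, c'' n = c' n) →
      ¬ Solves φ ψ f (intermediate f h (h.sol r) c'') := by
  -- Padding the finite prefix with zeros makes the sequence computable.
  set c' : Baire := fun n => (initSeg c N).getD n 0 with hc'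
  have cc' : Computable c' :=
    ((Primrec.list_getD 0).comp (Primrec.const (initSeg c N)) Primrec.id).to_comp
  refine ⟨c', fun n hn => by simp [hc', initSeg, hn], ?_⟩
  set G := sigma (consFamily h fun n => codedPoint f (h.sol r) (c' n + 1)) with hG
  have hGf : ¬ Solves φ ψ f G := fun H => hfh
    ((le_iff_exists_solves.2 ⟨φ, ψ, cφ, cψ, mφ, mψ, H⟩).trans (sigma_codedPoint_le hr hrc cc'))
  obtain ⟨p, hpf, hp⟩ : ∃ p ∈ f.dom, ¬ ∃ r, _ := by
    simpa only [Solves, not_forall, exists_prop] using hGf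
  have hsub : ∀ x, G.sol x ⊆ (intermediate f h (h.sol r) c').sol x := by
    intro x s hs
    cases h0 : x 0 with
    | zero => simpa only [hG, intermediate, sigma, h0, consFamily] using hs
    | succ n =>
      simp only [hG, intermediate, sigma, h0, consFamily] at hs ⊢
      exact Or.inr hs
  have hdom : ∀ x c'', x ∈ (intermediate f h (h.sol r) c'').dom → x ∈ G.dom := by
    rintro x c'' ⟨s, hs⟩
    cases h0 : x 0 with
    | zero => exact ⟨s, by simpa only [hG, intermediate, sigma, h0, consFamily] using hs⟩
    | succ n =>
      simp only [intermediate, sigma, h0, consFamily] at hs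
      obtain ⟨t, ht⟩ := hr
      refine ⟨Baire.cons (c' n + 1) t, ?_⟩
      simp only [hG, sigma, h0, consFamily]
      rcases hs with hs | hs
      · exact ⟨⟨_, hs.2⟩, rfl, ht⟩
      · exact ⟨hs.1, rfl, ht⟩
  by_contra! hcon
  -- The query `x` does not depend on the sequence, so any one yields it; then its tag `x 0` serves
  -- as the bound on agreement with `c'`.
  obtain ⟨c₀, -, H⟩ := hcon 0
  obtain ⟨x, hx, -⟩ := H p hpf
  obtain ⟨c'', hc'', H⟩ := hcon (x 0)
  obtain ⟨x', hx', hxd, K⟩ := H p hpf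
  obtain rfl := hx.unique hx'
  refine hp ⟨x, hx, hdom x c'' hxd, fun q hq => K q ?_⟩
  rw [intermediate_sol_congr hc'']
  exact hsub x hq

theorem exists_between_of_identity_le {f h : Problem} (hid : Problem.identity ≤ h) (hlt : h < f) :
    ∃ k, h < k ∧ k < f := by
  obtain ⟨r, hr, hrc⟩ := identity_le_iff.1 hid
  have hfh := hlt.not_ge
  -- The Boolean selects which of the two reductions the pair of word functions must fail to give.
  let ι := {φ : List ℕ → List ℕ | Computable φ} ×
    {ψ : List ℕ × List ℕ → List ℕ | Computable ψ} × Bool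
  have : Countable {φ : List ℕ → List ℕ | Computable φ} := countable_computable.to_subtype
  have : Countable {ψ : List ℕ × List ℕ → List ℕ | Computable ψ} :=
    countable_computable.to_subtype
  obtain ⟨c, hc⟩ := exists_forall_of_dense (ι := ι) (fun i c => MonoWord i.1.1 →
      MonoWord₂ (fun σ τ => i.2.1.1 (σ, τ)) →
      ¬ bif i.2.2 then Solves i.1.1 (fun σ τ => i.2.1.1 (σ, τ)) (intermediate f h (h.sol r) c) h
        else Solves i.1.1 (fun σ τ => i.2.1.1 (σ, τ)) f (intermediate f h (h.sol r) c)) (by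
    rintro ⟨⟨φ, cφ⟩, ⟨ψ, cψ⟩, b⟩ c N
    by_cases hm : MonoWord φ ∧ MonoWord₂ fun σ τ => ψ (σ, τ)
    · have cψ' : Computable₂ fun σ τ => ψ (σ, τ) := cψ
      cases b with
      | true =>
        obtain ⟨c', hc', M, hM⟩ :=
          dense_not_solves_intermediate_left hfh (h.sol r) cφ cψ' hm.1 hm.2 c N
        exact ⟨c', hc', M, fun c'' hc'' _ _ => hM c'' hc''⟩
      | false =>
        obtain ⟨c', hc', M, hM⟩ :=
          dense_not_solves_intermediate_right hfh hr hrc cφ cψ' hm.1 hm.2 c N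
        exact ⟨c', hc', M, fun c'' hc'' _ _ => hM c'' hc''⟩
    · exact ⟨c, fun _ _ => rfl, 0, fun _ _ h1 h2 => absurd ⟨h1, h2⟩ hm⟩)
  refine ⟨intermediate f h (h.sol r) c, ⟨le_sigma (consFamily h _) 0, fun hle => ?_⟩,
    ⟨intermediate_le hlt.le _ _, fun hle => ?_⟩⟩
  · obtain ⟨φ, ψ, cφ, cψ, mφ, mψ, H⟩ := le_iff_exists_solves.1 hle
    exact hc (⟨φ, cφ⟩, ⟨fun x => ψ x.1 x.2, cψ⟩, true) mφ mψ H
  · obtain ⟨φ, ψ, cφ, cψ, mφ, mψ, H⟩ := le_iff_exists_solves.1 hle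
    exact hc (⟨φ, cφ⟩, ⟨fun x => ψ x.1 x.2, cψ⟩, false) mφ mψ H

end Weihrauch

theorem mainTheorem3 (g : Weihrauch.Problem) :
    ¬ (Weihrauch.Problem.identity ≤ g) ↔
      ∃ f h : Weihrauch.Problem, g ≤ h ∧ h < f ∧
        Weihrauch.IsMinimalCover (Weihrauch.degree f) (Weihrauch.degree h) := by
  constructor
  · intro hg
    have hc := Weihrauch.join_identity_isMinimalCover hg
    exact ⟨_, _, Weihrauch.left_le_join g _, (Weihrauch.isMinimalCover_iff.1 hc).1, hc⟩
  · rintro ⟨f, h, hgh, hlt, hc⟩ hid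
    obtain ⟨k, hk, hk'⟩ := Weihrauch.exists_between_of_identity_le (hid.trans hgh) hlt
    exact (Weihrauch.isMinimalCover_iff.1 hc).2 k hk hk'
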